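/- Let $X,Y$ be real vector spaces and $c=\langle\cdot,\cdot\rangle:X\times Y\to\mathbb{R}$ a bilinear map (no separation is assumed); $\sigma(X,Y)$ denotes the weakest topology on $X$ making all forms $\langle\cdot,y\rangle$, $y\in Y$, continuous, and $\sigma(Y,X)$ the weakest topology on $Y$ making all forms $\langle x,\cdot\rangle$, $x\in X$, continuous. For $T:X\rightrightarrows Y$ with $\operatorname{Graph}T=\{(x,y)\mid y\in T(x)\}$, say that $(x,y)\in X\times Y$ is monotonically related to $T$ if $\langle x-u,y-v\rangle\ge 0$ for all $(u,v)\in\operatorname{Graph}T$; let $T^+:X\rightrightarrows Y$ be the operator whose graph is the set of all such $(x,y)$; $T$ is monotone if every point of $\operatorname{Graph}T$ is monotonically related to $T$. Let $c_T:X\times Y\to\overline{\mathbb{R}}$ equal $c$ on $\operatorname{Graph}T$ and $+\infty$ elsewhere, and let $\operatorname{conv}c_T(z)=\inf\{t\in\mathbb{R}\mid (z,t)\in\operatorname{conv}(\operatorname{Epi}c_T)\}$ be its convex hull, where $\operatorname{Epi}c_T=\{(z,t)\in (X\times Y)\times\mathbb{R}\mid c_T(z)\le t\}$. Theorem. Let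 $\emptyset\neq K\subset X$ be convex, let $f:K\to Y$ have range $R(f)$ and graph $\operatorname{Graph}f\subset X\times Y$, and let $T:X\rightrightarrows Y$ be monotone with non-empty graph, such that $$\forall (x,y)\in\operatorname{conv}(\operatorname{Graph}T),\ \forall w\in R(f),\quad \operatorname{conv}c_T(x,y)\ \ge\ \inf_{k\in K}\langle k,y-w\rangle+\langle x,w\rangle .$$ Let $\beta_X$ be a Hausdorff locally convex (vector space) topology on $X$ such that $(K,\beta_X)$ and $(\operatorname{Graph}f,\beta_X\times\sigma(Y,X))$ are compact. Assume that $\beta_X$ is finer than $\sigma(X,Y)$ on $K$ and that $c:(\operatorname{Graph}f,\beta_X\times\sigma(Y,X))\to\mathbb{R}$ is upper semicontinuous. Then $\operatorname{Graph}(T^+)\cap\operatorname{Graph}f\neq\emptyset$; that is, there is $x\in K$ such that $(x,f(x))$ is monotonically related to $T$. -/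

import Mathlib

namespace DualSystem

section Weak

variable {X Y : Type*} [AddCommGroup X] [Module ℝ X] [AddCommGroup Y] [Module ℝ Y]

/-- The topology `σ(X, Y)` on `X` of the dual system `(X, Y, c)`: the weakest topology for which
all the forms `x ↦ c x y`, `y ∈ Y`, are continuous (Mathlib's topology of `WeakBilin c`). -/
abbrev sigmaLeft (c : X →ₗ[ℝ] Y →ₗ[ℝ] ℝ) : TopologicalSpace X :=
  inferInstanceAs (TopologicalSpace (WeakBilin c))

/-- The topology `σ(Y, X)` on `Y` of the dual system `(X, Y, c)`. -/
abbrev sigmaRight (c : X →ₗ[ℝ] Y →ₗ[ℝ] ℝ) : TopologicalSpace Y :=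
  sigmaLeft c.flip

end Weak

/-- The graph of a multi-valued operator `T : X ⇉ Y`. -/
def graph {X Y : Type*} (T : X → Set Y) : Set (X × Y) :=
  {z | z.2 ∈ T z.1}

/-- The graph, as a subset of `X × Y`, of a function `f : K → Y` defined on `K ⊆ X`. -/
def funGraph {X Y : Type*} {K : Set X} (f : K → Y) : Set (X × Y) :=
  Set.range fun k : K => ((k : X), f k)

/-- `T : X ⇉ Y` is monotone. -/
def IsMonotone {X Y : Type*} [AddCommGroup X] [Module ℝ X] [AddCommGroup Y] [Module ℝ Y]
    (c : X →ₗ[ℝ] Y →ₗ[ℝ] ℝ) (T : X → Set Y) : Prop :=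
  ∀ x₁ x₂ : X, ∀ y₁ ∈ T x₁, ∀ y₂ ∈ T x₂, 0 ≤ c (x₁ - x₂) (y₁ - y₂)

/-- `z` is monotonically related to `A ⊆ X × Y`. -/
def IsMonotonicallyRelated {X Y : Type*} [AddCommGroup X] [Module ℝ X] [AddCommGroup Y]
    [Module ℝ Y] (c : X →ₗ[ℝ] Y →ₗ[ℝ] ℝ) (z : X × Y) (A : Set (X × Y)) : Prop :=
  ∀ w ∈ A, 0 ≤ c (z.1 - w.1) (z.2 - w.2)

/-- The operator `T⁺ : X ⇉ Y`, whose graph is the set of all points of `X × Y` that are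
monotonically related to `T`. -/
def plus {X Y : Type*} [AddCommGroup X] [Module ℝ X] [AddCommGroup Y] [Module ℝ Y]
    (c : X →ₗ[ℝ] Y →ₗ[ℝ] ℝ) (T : X → Set Y) : X → Set Y :=
  fun x => {y | IsMonotonicallyRelated c (x, y) (graph T)}

/-- The epigraph of an extended-real-valued function. -/
def epi {E : Type*} (g : E → EReal) : Set (E × ℝ) :=
  {p | g p.1 ≤ (p.2 : EReal)}

/-- The convex hull `conv g` of an extended-real-valued function,
`(conv g)(x) = inf {t ∈ ℝ | (x, t) ∈ conv (Epi g)}`, with `inf ∅ = +∞`. -/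
noncomputable def convFun {E : Type*} [AddCommGroup E] [Module ℝ E] (g : E → EReal) : E → EReal :=
  fun x => sInf ((fun t : ℝ => (t : EReal)) '' {t : ℝ | (x, t) ∈ convexHull ℝ (epi g)})

open Classical in
/-- The function `c_T = c + ι_{Graph T}`: equal to `c` on the graph of `T`, `+∞` elsewhere. -/
noncomputable def couplingOn {X Y : Type*} [AddCommGroup X] [Module ℝ X] [AddCommGroup Y]
    [Module ℝ Y] (c : X →ₗ[ℝ] Y →ₗ[ℝ] ℝ) (T : X → Set Y) : X × Y → EReal :=
  fun z => if z ∈ graph T then ((c z.1 z.2 : ℝ) : EReal) else ⊤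

end DualSystem

/-!
The theorem rests on Brouwer's fixed point theorem, which is proved here from scratch.

Suppose that no `(x, f x)`, `x ∈ K`, is monotonically related to `T`. Compactness of the graph of
`f` makes `x ↦ (x, f x)` continuous on `K` (`continuous_graphMap_of_isCompact`), so for each `(u, v)`
in the graph of `T` the set of all `x ∈ K` with `c (x - u) (f x - v) < 0` is open in `K`. These sets
cover `K`; averaging with a finite partition of unity gives a continuous map `x ↦ (u x, v x)` into
the convex hull of the graph of `T`, and the upper bound
`conv c_T (u x, v x) < c x (v x) + c (u x) (f x) - c x (f x)`. The assumed lower bound for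
`conv c_T` at `(u x, v x)` with `w = f x` then yields, for each `x`, some `k ∈ K` with
`c (k - x) (v x - f x) < 0`. For fixed `k` this is an open condition on `x`, so by the fixed point
theorem in Browder's form (`exists_mem_convexHull_of_open_cover`) some `x` is a convex combination
of points `k` with `c (k - x) (v x - f x) < 0`. Averaging gives `0 = c (x - x) (v x - f x) < 0`.

Brouwer's theorem for the simplex (`stdSimplex.exists_fixedPoint`) is derived from a combinatorial
lemma of Scarf (`Scarf.exists_colorful`) about several linear orders on one finite set, which plays
the role of Sperner's lemma and needs no triangulation. Its proof is a parity count of pairs of a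
dominant set with one element per order ("room") and a subset with one element less ("door").
-/

/-! ### Scarf's lemma -/

namespace Scarf

open Finset

variable {I V α : Type*} [LinearOrder α]

/-- A finite set `S` is dominant for the orders `ρ i` if no `y` lies strictly above the minimum of
`S` in all of them. -/
def IsDominant (ρ : I → V → α) (S : Finset V) : Prop :=
  ∀ y, ∃ i, ∀ x ∈ S, ρ i y ≤ ρ i x

theorem IsDominant.mono {ρ : I → V → α} {R S : Finset V} (hS : IsDominant ρ S) (h : R ⊆ S) :
    IsDominant ρ R := fun y => (hS y).imp fun _ hi x hx => hi x (h hx)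

theorem not_le_of_notMem_range {ρ : I → V → α} {e : I → V}
    (hρ : ∀ i, Function.Injective (ρ i))
    (hmine : ∀ i y, ρ i (e i) ≤ ρ i y) {y : V} (hy : y ∉ Set.range e) (i : I) :
    ¬ ρ i y ≤ ρ i (e i) := fun h =>
  hy ⟨i, hρ i (le_antisymm (hmine i y) h)⟩

/-- The room side of the count: a set with one element per colour that misses some colour has an
even number of facets carrying exactly the colours other than `i₀`. -/
theorem even_card_facets [Fintype I] [DecidableEq I] [Fintype V] [DecidableEq V] (c : V → I)
    (i₀ : I) {S : Finset V} (hS : #S = Fintype.card I) (hc : S.image c ≠ univ) :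
    Even #{R : Finset V | (#R + 1 = Fintype.card I ∧ R.image c = univ.erase i₀) ∧ R ⊆ S} := by
  rcases Finset.eq_empty_or_nonempty
    {R : Finset V | (#R + 1 = Fintype.card I ∧ R.image c = univ.erase i₀) ∧ R ⊆ S} with h | ⟨R, hR⟩
  · rw [h]; simp
  simp only [mem_filter, mem_univ, true_and] at hR
  obtain ⟨⟨hRc, hRi⟩, hRS⟩ := hR
  obtain ⟨x, hxR, rfl⟩ := Finset.exists_eq_insert_iff.2 ⟨hRS, hRc.trans hS.symm⟩
  have hinj : Set.InjOn c R := by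
    rw [← Finset.card_image_iff, hRi, card_erase_of_mem (mem_univ _), card_univ]
    omega
  have hcx : c x ≠ i₀ := by
    rintro rfl
    exact hc (by rw [image_insert, hRi, insert_erase (mem_univ _)])
  have : c x ∈ R.image c := by rw [hRi]; simp [hcx]
  obtain ⟨x', hx'R, hx'⟩ := mem_image.1 this
  have hxx' : x ≠ x' := by rintro rfl; exact hxR hx'R
  have key : ({R' : Finset V | (#R' + 1 = Fintype.card I ∧ R'.image c = univ.erase i₀) ∧
      R' ⊆ insert x R} : Finset (Finset V)) = {R, insert x (R.erase x')} := by
    ext R'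
    simp only [mem_filter, mem_univ, true_and, mem_insert, mem_singleton]
    constructor
    · rintro ⟨⟨h1, h2⟩, h3⟩
      obtain ⟨z, hz, hzS⟩ := Finset.exists_eq_insert_iff.2 ⟨h3, h1.trans hS.symm⟩
      have hR' : R' = (insert x R).erase z := by rw [← hzS, erase_insert hz]
      by_cases hzx : z = x
      · left; rw [hR', hzx, erase_insert hxR]
      by_cases hzx' : z = x'
      · right
        rw [hR', hzx', erase_insert_of_ne hxx']
      exfalso
      have hzR : z ∈ R := by
        have : z ∈ insert x R := by rw [← hzS]; simp
        simpa [hzx] using this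
      have : c z ∈ R'.image c := by rw [h2, ← hRi]; exact mem_image_of_mem _ hzR
      obtain ⟨w, hw, hwz⟩ := mem_image.1 this
      have hne : w ≠ z := by rintro rfl; exact hz hw
      rcases mem_insert.1 (h3 hw) with rfl | hwR
      · exact hzx' (hinj hzR hx'R (hwz.symm.trans hx'.symm))
      · exact hne (hinj hwR hzR hwz)
    · rintro (rfl | rfl)
      · exact ⟨⟨hRc, hRi⟩, subset_insert _ _⟩
      · refine ⟨⟨?_, ?_⟩, insert_subset_insert _ (erase_subset _ _)⟩
        · rw [card_insert_of_notMem (by simp [hxR]), card_erase_of_mem hx'R]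
          have := card_pos.2 ⟨x', hx'R⟩
          omega
        · rw [image_insert, ← hx', ← image_insert, insert_erase hx'R, hRi]
  rw [key, card_pair]
  · exact even_two
  · intro h
    exact hxR (by rw [h]; simp)

/-- The elements of `V` that lie above the point `m k` in the order `ρ k`, for every `k ≠ i`. -/
def above [Fintype I] [DecidableEq I] [Fintype V] (ρ : I → V → α) (m : I → V) (i : I) : Finset V :=
  {y | ∀ k, k ≠ i → ρ k (m k) < ρ k y}

variable [Fintype I] [DecidableEq I] [Fintype V]

theorem mem_above {ρ : I → V → α} {m : I → V} {i : I} {y : V} :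
    y ∈ above ρ m i ↔ ∀ k, k ≠ i → ρ k (m k) < ρ k y := by simp [above]

/-- If `i` and `j` are the two orders in which the dominant set `R` has the same minimum, then the
one-point dominant extensions of `R` replace the minimum in the order `i` or in the order `j`. -/
theorem isDominant_insert_iff [DecidableEq V] {ρ : I → V → α} {R : Finset V}
    (hR : IsDominant ρ R) {m : I → V} (hm : ∀ i, m i ∈ R) (hmin : ∀ i, ∀ x ∈ R, ρ i (m i) ≤ ρ i x)
    {i j : I} (hij : i ≠ j) (hmij : m i = m j)
    (hi : Set.InjOn m {i}ᶜ) (hj : Set.InjOn m {j}ᶜ)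
    (hρ : ∀ i, Function.Injective (ρ i)) (x : V) :
    (x ∉ R ∧ IsDominant ρ (insert x R)) ↔
      (x ∈ above ρ m i ∧ ∀ y ∈ above ρ m i, ρ i y ≤ ρ i x) ∨
      (x ∈ above ρ m j ∧ ∀ y ∈ above ρ m j, ρ j y ≤ ρ j x) := by
  have hsurj : ∀ z ∈ R, ∃ k, m k = z := fun z hz => by
    obtain ⟨k, hk⟩ := hR z
    exact ⟨k, hρ k (le_antisymm (hmin k z hz) (hk _ (hm k)))⟩
  -- the collision `m i = m j` is the only one
  have huniq : ∀ k k', k ≠ i → k ≠ j → m k = m k' → k = k' := fun k k' h1 h2 h => by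
    by_cases h3 : k' = i
    · exact hj h2 (by simpa [h3] using hij) h
    · exact hi h1 h3 h
  have back : ∀ i j, i ≠ j → m i = m j → ∀ x, x ∈ above ρ m i →
      (∀ y ∈ above ρ m i, ρ i y ≤ ρ i x) → x ∉ R ∧ IsDominant ρ (insert x R) := by
    intro i j hij hmij x hx hmax
    rw [mem_above] at hx
    refine ⟨fun hxR => ?_, fun y => ?_⟩
    · obtain ⟨k, rfl⟩ := hsurj x hxR
      by_cases hk : k = i
      · subst hk
        exact absurd (hx j hij.symm) (by rw [hmij]; exact lt_irrefl _)
      · exact lt_irrefl _ (hx k hk)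
    · by_contra! hcon
      have hy : y ∈ above ρ m i := by
        rw [mem_above]
        intro k hk
        obtain ⟨z, hz, hzy⟩ := hcon k
        rcases mem_insert.1 hz with rfl | hzR
        · exact (hx k hk).trans hzy
        · exact (hmin k z hzR).trans_lt hzy
      obtain ⟨z, hz, hzy⟩ := hcon i
      have hyx := hmax y hy
      rcases mem_insert.1 hz with rfl | hzR
      · exact absurd hyx (not_le.2 hzy)
      -- now `x` itself lies strictly above the minimum of `R` in every order
      obtain ⟨k, hk⟩ := hR x
      by_cases hki : k = i
      · subst hki
        exact absurd (hk z hzR) (not_le.2 (hzy.trans_le hyx))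
      · exact absurd (hk _ (hm k)) (not_le.2 (hx k hki))
  constructor
  · rintro ⟨hxR, hdom⟩
    have hdomR : ∀ z ∈ R, ∃ k, m k = z ∧ ρ k z ≤ ρ k x := fun z hz => by
      obtain ⟨k, hk⟩ := hdom z
      exact ⟨k, hρ k (le_antisymm (hmin k z hz) (hk _ (mem_insert_of_mem (hm k)))),
        hk x (mem_insert_self _ _)⟩
    have hne : ∀ k, ρ k (m k) ≠ ρ k x := fun k h => hxR (hρ k h ▸ hm k)
    have hmem : x ∈ above ρ m i ∨ x ∈ above ρ m j := by
      by_contra! hcon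
      simp only [mem_above, not_forall, not_lt] at hcon
      obtain ⟨⟨k, hki, hk⟩, ⟨l, hlj, hl⟩⟩ := hcon
      have hbad : ∀ k, k ≠ i → k ≠ j → ¬ ρ k x ≤ ρ k (m k) := fun k h1 h2 h => by
        obtain ⟨k', h3, h4⟩ := hdomR _ (hm k)
        obtain rfl := huniq k k' h1 h2 h3.symm
        exact hne k (le_antisymm h4 h)
      have hkj : k = j := by by_contra h; exact hbad k hki h hk
      have hli : l = i := by by_contra h; exact hbad l h hlj hl
      subst hkj hli
      obtain ⟨k', h3, h4⟩ := hdomR _ (hm l)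
      have : k' = l ∨ k' = k := by
        by_contra! h
        exact h.1 (huniq k' l h.1 h.2 h3)
      rcases this with rfl | rfl
      · exact hne _ (le_antisymm h4 hl)
      · rw [hmij] at h4
        exact hne _ (le_antisymm h4 hk)
    have hmax : ∀ i, x ∈ above ρ m i → ∀ y ∈ above ρ m i, ρ i y ≤ ρ i x := by
      intro i _ y hy
      rw [mem_above] at hy
      obtain ⟨k, hk⟩ := hdom y
      by_cases hki : k = i
      · subst hki; exact hk x (mem_insert_self _ _)
      · exact absurd (hk _ (mem_insert_of_mem (hm k))) (not_le.2 (hy k hki))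
    exact hmem.imp (fun h => ⟨h, hmax i h⟩) (fun h => ⟨h, hmax j h⟩)
  · rintro (⟨h1, h2⟩ | ⟨h1, h2⟩)
    · exact back i j hij hmij x h1 h2
    · exact back j i hij.symm hmij.symm x h1 h2

variable {ρ : I → V → α} {e : I → V}

open Classical in
/-- A dominant set of `|I| - 1` elements that are not all of the form `e i` has exactly two
one-point dominant extensions. -/
theorem card_extensions_eq_two [DecidableEq V] (hρ : ∀ i, Function.Injective (ρ i))
    (hmine : ∀ i y, ρ i (e i) ≤ ρ i y)
    (hmaxe : ∀ i k, k ≠ i → ∀ y, y ∉ Set.range e → ρ k y < ρ k (e i))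
    {R : Finset V} (hR : IsDominant ρ R) (hcard : #R + 1 = Fintype.card I)
    {t : V} (ht : t ∈ R) (hte : t ∉ Set.range e) :
    #{x | x ∉ R ∧ IsDominant ρ (insert x R)} = 2 := by
  choose m hm hmin using fun i => R.exists_min_image (ρ i) ⟨t, ht⟩
  have hsurj : ∀ z ∈ R, ∃ k, m k = z := fun z hz => by
    obtain ⟨k, hk⟩ := hR z
    exact ⟨k, hρ k (le_antisymm (hmin k z hz) (hk _ (hm k)))⟩
  obtain ⟨i, -, j, -, hij, hmij⟩ := exists_ne_map_eq_of_card_lt_of_maps_to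
    (s := (univ : Finset I)) (t := R) (by rw [card_univ]; omega) (f := m) (fun k _ => hm k)
  have hinj : ∀ i j, i ≠ j → m i = m j → Set.InjOn m {i}ᶜ := by
    intro i j hij hmij
    have himg : (univ.erase i).image m = R := by
      ext z
      simp only [mem_image, mem_erase, mem_univ, and_true]
      constructor
      · rintro ⟨k, -, rfl⟩; exact hm k
      · intro hz
        obtain ⟨k, rfl⟩ := hsurj z hz
        by_cases hk : k = i
        · exact ⟨j, hij.symm, by rw [hk, hmij]⟩
        · exact ⟨k, hk, rfl⟩
    have h := Finset.card_image_iff (s := univ.erase i) (f := m)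
    rw [himg, card_erase_of_mem (mem_univ _), card_univ] at h
    have h' := h.1 (by omega)
    intro a ha b hb hab
    exact h' (by simpa using ha) (by simpa using hb) hab
  have hne : ∀ i j, i ≠ j → m i = m j → (above ρ m i).Nonempty := by
    intro i j hij hmij
    have hei : e i ∉ R := fun h => by
      have h1 : m i = e i := hρ i (le_antisymm (hmin i _ h) (hmine i _))
      have h2 := hmin j t ht
      rw [← hmij, h1] at h2
      exact absurd (hmaxe i j hij.symm t hte) (not_lt.2 h2)
    exact ⟨e i, mem_above.2 fun k hk => (hmin k t ht).trans_lt (hmaxe i k hk t hte)⟩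
  obtain ⟨a, ha, ha'⟩ := (above ρ m i).exists_max_image (ρ i) (hne i j hij hmij)
  obtain ⟨b, hb, hb'⟩ := (above ρ m j).exists_max_image (ρ j) (hne j i hij.symm hmij.symm)
  have hab : a ≠ b := by
    rintro rfl
    obtain ⟨k, hk⟩ := hR a
    rw [mem_above] at ha hb
    by_cases hki : k = i
    · exact absurd (hk _ (hm k)) (not_le.2 (hb k (hki ▸ hij)))
    · exact absurd (hk _ (hm k)) (not_le.2 (ha k hki))
  have : ({x | x ∉ R ∧ IsDominant ρ (insert x R)} : Finset V) = {a, b} := by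
    ext x
    rw [mem_filter, isDominant_insert_iff hR hm hmin hij hmij (hinj i j hij hmij)
      (hinj j i hij.symm hmij.symm) hρ x, mem_insert, mem_singleton]
    constructor
    · rintro ⟨-, ⟨h1, h2⟩ | ⟨h1, h2⟩⟩
      · exact Or.inl (hρ i (le_antisymm (ha' x h1) (h2 a ha)))
      · exact Or.inr (hρ j (le_antisymm (hb' x h1) (h2 b hb)))
    · rintro (rfl | rfl)
      · exact ⟨mem_univ _, Or.inl ⟨ha, ha'⟩⟩
      · exact ⟨mem_univ _, Or.inr ⟨hb, hb'⟩⟩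
  rw [this, card_pair hab]

open Classical in
/-- The set of all `e i` with `i ≠ i₀` is dominant and has exactly one one-point dominant extension:
by the maximum, in the order `i₀`, of the elements outside the range of `e`. -/
theorem isDominant_boundary_and_card_extensions [DecidableEq V]
    (hρ : ∀ i, Function.Injective (ρ i))
    (hmine : ∀ i y, ρ i (e i) ≤ ρ i y)
    (hmaxe : ∀ i k, k ≠ i → ∀ y, y ∉ Set.range e → ρ k y < ρ k (e i))
    (hne : ∃ t, t ∉ Set.range e) (i₀ : I) :
    IsDominant ρ ((univ.erase i₀).image e) ∧
    #{x | x ∉ (univ.erase i₀).image e ∧ IsDominant ρ (insert x ((univ.erase i₀).image e))} = 1 := by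
  have hmem : ∀ x, x ∈ (univ.erase i₀).image e ↔ ∃ i, i ≠ i₀ ∧ e i = x := by simp
  obtain ⟨t, ht⟩ := hne
  obtain ⟨a, ha, hamax⟩ := ({y | y ∉ Set.range e} : Finset V).exists_max_image (ρ i₀)
    ⟨t, by simpa using ht⟩
  have ha : a ∉ Set.range e := (mem_filter.1 ha).2
  have hamax : ∀ y, y ∉ Set.range e → ρ i₀ y ≤ ρ i₀ a := fun y hy =>
    hamax y (mem_filter.2 ⟨mem_univ _, hy⟩)
  have hdom : IsDominant ρ (insert a ((univ.erase i₀).image e)) := by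
    intro y
    by_cases hy : y ∈ Set.range e
    · obtain ⟨i, rfl⟩ := hy
      exact ⟨i, fun x _ => hmine i x⟩
    · refine ⟨i₀, fun x hx => ?_⟩
      rcases mem_insert.1 hx with rfl | hx
      · exact hamax y hy
      · obtain ⟨i, hi, rfl⟩ := (hmem x).1 hx
        exact (hmaxe i i₀ hi.symm y hy).le
  refine ⟨hdom.mono (subset_insert _ _), ?_⟩
  rw [card_eq_one]
  refine ⟨a, ?_⟩
  ext x
  simp only [mem_filter, mem_univ, true_and, mem_singleton]
  constructor
  · rintro ⟨hx, hd⟩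
    -- in an order `k ≠ i₀` nothing outside the range of `e` lies below `e k`
    have hi₀ : ∀ y, y ∉ Set.range e → ρ i₀ y ≤ ρ i₀ x := fun y hy => by
      obtain ⟨k, hk⟩ := hd y
      by_cases hki : k = i₀
      · subst hki; exact hk x (mem_insert_self _ _)
      · exact absurd (hk (e k) (mem_insert_of_mem ((hmem _).2 ⟨k, hki, rfl⟩)))
          (not_le_of_notMem_range hρ hmine hy k)
    have hxe : x ∉ Set.range e := by
      rintro ⟨i, rfl⟩
      by_cases hi : i = i₀
      · subst hi
        exact not_le_of_notMem_range hρ hmine ht i (hi₀ t ht)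
      · exact hx ((hmem _).2 ⟨i, hi, rfl⟩)
    exact hρ i₀ (le_antisymm (hamax x hxe) (hi₀ a ha))
  · rintro rfl
    refine ⟨fun h => ?_, hdom⟩
    obtain ⟨i, -, hi⟩ := (hmem x).1 h
    exact ha ⟨i, hi⟩

/-- Scarf's lemma in symmetric form, with a boundary vertex `e i` of colour `i` for each order
`ρ i`: some dominant set carries every colour exactly once. -/
theorem exists_isDominant_rainbow [Nonempty I] (hρ : ∀ i, Function.Injective (ρ i))
    (he : Function.Injective e) (hmine : ∀ i y, ρ i (e i) ≤ ρ i y)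
    (hmaxe : ∀ i k, k ≠ i → ∀ y, y ∉ Set.range e → ρ k y < ρ k (e i))
    (hne : ∃ t, t ∉ Set.range e) (c : V → I) (hc : ∀ i, c (e i) = i) :
    ∃ S : Finset V, IsDominant ρ S ∧ S.image c = univ := by
  classical
  by_contra! hcon
  obtain ⟨i₀⟩ := ‹Nonempty I›
  let rooms : Finset (Finset V) := {S | IsDominant ρ S ∧ #S = Fintype.card I}
  let doors : Finset (Finset V) :=
    {R | IsDominant ρ R ∧ #R + 1 = Fintype.card I ∧ R.image c = univ.erase i₀}
  let R₀ : Finset V := (univ.erase i₀).image e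
  obtain ⟨hR₀, hR₀card⟩ := isDominant_boundary_and_card_extensions hρ hmine hmaxe hne i₀
  have hR₀doors : R₀ ∈ doors := by
    have hpos : 0 < Fintype.card I := Fintype.card_pos_iff.2 ⟨i₀⟩
    simp only [doors, mem_filter, mem_univ, true_and]
    refine ⟨hR₀, ?_, ?_⟩
    · rw [card_image_of_injective _ he, card_erase_of_mem (mem_univ _), card_univ]
      omega
    · rw [image_image, show c ∘ e = id from funext hc, image_id]
  have hcount := sum_card_bipartiteAbove_eq_sum_card_bipartiteBelow
    (s := rooms) (t := doors) (fun S R => R ⊆ S)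
  have heven : Even (∑ S ∈ rooms, #(doors.bipartiteAbove (fun S R => R ⊆ S) S)) := by
    refine Finset.even_sum _ fun S hS => ?_
    simp only [rooms, mem_filter, mem_univ, true_and] at hS
    have heq : doors.bipartiteAbove (fun S R => R ⊆ S) S =
        ({R : Finset V | (#R + 1 = Fintype.card I ∧ R.image c = univ.erase i₀) ∧ R ⊆ S} :
          Finset (Finset V)) := by
      ext R
      simp only [doors, bipartiteAbove, mem_filter, mem_univ, true_and]
      exact ⟨fun h => ⟨h.1.2, h.2⟩, fun h => ⟨⟨hS.1.mono h.2, h.1⟩, h.2⟩⟩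
    rw [heq]
    exact even_card_facets c i₀ hS.2 (hcon S hS.1)
  have hext : ∀ R ∈ doors, #(rooms.bipartiteBelow (fun S R => R ⊆ S) R) =
      #{x | x ∉ R ∧ IsDominant ρ (insert x R)} := by
    intro R hR
    simp only [doors, mem_filter, mem_univ, true_and] at hR
    have himg : rooms.bipartiteBelow (fun S R => R ⊆ S) R =
        ({x | x ∉ R ∧ IsDominant ρ (insert x R)} : Finset V).image (fun x => insert x R) := by
      ext S
      simp only [rooms, bipartiteBelow, mem_filter, mem_univ, true_and, mem_image]
      constructor
      · rintro ⟨⟨h1, h2⟩, h3⟩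
        obtain ⟨x, hx, rfl⟩ := Finset.exists_eq_insert_iff.2 ⟨h3, hR.2.1.trans h2.symm⟩
        exact ⟨x, ⟨hx, h1⟩, rfl⟩
      · rintro ⟨x, ⟨hx, h1⟩, rfl⟩
        exact ⟨⟨h1, (card_insert_of_notMem hx).trans hR.2.1⟩, subset_insert _ _⟩
    rw [himg, card_image_of_injOn]
    intro x hx y _ hxy
    have hx : x ∉ R := (mem_filter.1 hx).2.1
    have : x ∈ insert y R := by
      rw [← show insert x R = insert y R from hxy]; exact mem_insert_self _ _
    exact (mem_insert.1 this).resolve_right hx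
  have hrest : Even (∑ R ∈ doors.erase R₀, #(rooms.bipartiteBelow (fun S R => R ⊆ S) R)) := by
    refine Finset.even_sum _ fun R hR => ?_
    obtain ⟨hRne, hRd⟩ := mem_erase.1 hR
    rw [hext R hRd]
    simp only [doors, mem_filter, mem_univ, true_and] at hRd
    obtain ⟨t, htR, hte⟩ : ∃ t ∈ R, t ∉ Set.range e := by
      by_contra! hall
      refine hRne ?_
      have hsub : R ⊆ R₀ := fun x hx => by
        obtain ⟨i, rfl⟩ := hall x hx
        have : c (e i) ∈ univ.erase i₀ := hRd.2.2 ▸ mem_image_of_mem c hx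
        rw [hc] at this
        exact mem_image_of_mem e this
      refine eq_of_subset_of_card_le hsub ?_
      have : #R₀ + 1 = Fintype.card I := by
        simp only [doors, mem_filter, mem_univ, true_and] at hR₀doors
        exact hR₀doors.2.1
      omega
    rw [card_extensions_eq_two hρ hmine hmaxe hRd.1 hRd.2.1 htR hte]
    exact even_two
  rw [hcount, ← add_sum_erase _ _ hR₀doors, hext _ hR₀doors, hR₀card] at heven
  rw [Nat.even_add] at heven
  exact absurd (heven.2 hrest) (by decide)

/-- Scarf's lemma: for finitely many linear orders on a finite set `T` and a colouring of `T` by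
the orders, there is a set `σ` such that no `y` lies strictly above the minimum of `σ` in all the
orders whose colour occurs on `σ`. The orders are given by injective functions to `ℕ`. -/
theorem exists_colorful {T : Type*} [Fintype T] [Nonempty T] [Nonempty I] (ρ : I → T → ℕ)
    (hρ : ∀ i, Function.Injective (ρ i)) (c : T → I) :
    ∃ σ : Finset T, ∀ y, ∃ i ∈ σ.image c, ∀ x ∈ σ, ρ i y ≤ ρ i x := by
  classical
  obtain ⟨N, hN⟩ : ∃ N, ∀ i t, ρ i t < N := by
    refine ⟨(univ.sup fun p : I × T => ρ p.1 p.2) + 1, fun i t => Nat.lt_succ_of_le ?_⟩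
    exact le_sup (f := fun p : I × T => ρ p.1 p.2) (mem_univ (i, t))
  let q := Fintype.equivFin I
  -- the boundary vertex `i` is the minimum in the order `i`, and above all of `T` in the others
  let r : I → T ⊕ I → ℕ := fun i =>
    Sum.elim (fun t => ρ i t + 1) (fun j => if j = i then 0 else N + 1 + q j)
  have hr : ∀ i, Function.Injective (r i) := by
    rintro i (t | j) (t' | j') h
    · simp only [r, Sum.elim_inl] at h
      rw [hρ i (Nat.succ_injective h)]
    · simp only [r, Sum.elim_inl, Sum.elim_inr] at h
      have := hN i t
      split_ifs at h
      omega
    · simp only [r, Sum.elim_inl, Sum.elim_inr] at h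
      have := hN i t'
      split_ifs at h
      omega
    · simp only [r, Sum.elim_inr] at h
      split_ifs at h with h1 h2 h2
      · rw [h1, h2]
      · omega
      · omega
      · rw [q.injective (Fin.ext (by omega : (q j : ℕ) = q j'))]
  obtain ⟨S, hS, hSc⟩ := exists_isDominant_rainbow (ρ := r) (e := Sum.inr) hr Sum.inr_injective
    (fun i y => by simp [r])
    (fun i k hk y hy => by
      rcases y with t | j
      · have := hN k t
        simp only [r, Sum.elim_inl, Sum.elim_inr, if_neg (Ne.symm hk)]
        omega
      · exact absurd ⟨j, rfl⟩ hy)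
    ⟨Sum.inl (Classical.arbitrary T), by simp⟩ (Sum.elim c id) (fun i => rfl)
  refine ⟨({t | Sum.inl t ∈ S} : Finset T), fun y => ?_⟩
  obtain ⟨i, hi⟩ := hS (Sum.inl y)
  have hiS : Sum.inr i ∉ S := fun h => by
    have := hi _ h
    simp [r] at this
  refine ⟨i, ?_, fun x hx => ?_⟩
  · have : i ∈ S.image (Sum.elim c id) := by rw [hSc]; exact mem_univ _
    obtain ⟨z, hz, hzi⟩ := mem_image.1 this
    rcases z with t | j
    · exact mem_image.2 ⟨t, by simpa using hz, hzi⟩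
    · obtain rfl : j = i := hzi
      exact absurd hz hiS
  · have := hi _ (mem_filter.1 hx).2
    simpa [r] using this

end Scarf

/-! ### Brouwer's fixed point theorem on the standard simplex -/

section Brouwer

open Finset Filter Topology

variable {I : Type*} [Fintype I]

/-- The grid of points of the simplex with coordinates in `(1/N) ℤ`, scaled by `N`. -/
abbrev SimplexGrid (I : Type*) [Fintype I] (N : ℕ) : Type _ :=
  {t : I → Fin (N + 1) // ∑ i, (t i : ℕ) = N}

/-- A vector of natural numbers with sum `N` is a point of the grid. -/
def SimplexGrid.mk {N : ℕ} (y : I → ℕ) (hy : ∑ i, y i = N) : SimplexGrid I N :=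
  ⟨fun i => ⟨y i, Nat.lt_succ_of_le (hy ▸ single_le_sum (f := y) (fun _ _ => Nat.zero_le _)
    (mem_univ i))⟩, hy⟩

/-- The point of the simplex given by a grid point. -/
noncomputable def SimplexGrid.point {N : ℕ} (t : SimplexGrid I N) : I → ℝ :=
  fun i => ((t.1 i : ℕ) : ℝ) / N

theorem SimplexGrid.point_mem {N : ℕ} (hN : 0 < N) (t : SimplexGrid I N) :
    t.point ∈ stdSimplex ℝ I := by
  refine ⟨fun i => by unfold SimplexGrid.point; positivity, ?_⟩
  simp only [SimplexGrid.point]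
  rw [← sum_div, ← Nat.cast_sum, t.2]
  exact div_self (by positivity)

/-- A set of grid points none of which is beaten in all the coordinates of `C` is small: its points
have coordinates within `|I|` of each other, and at most `|I|` outside `C`. -/
theorem SimplexGrid.close_of_dominant {N : ℕ} {σ : Finset (SimplexGrid I N)} {C : Finset I}
    (h : ∀ y : SimplexGrid I N, ∃ i ∈ C, ∀ x ∈ σ, (y.1 i : ℕ) ≤ x.1 i)
    {x : SimplexGrid I N} (hx : x ∈ σ) (i : I) :
    (i ∈ C → ∀ x' ∈ σ, (x.1 i : ℕ) ≤ x'.1 i + Fintype.card I) ∧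
      (i ∉ C → (x.1 i : ℕ) ≤ Fintype.card I) := by
  classical
  choose m hm hmin using fun i => σ.exists_min_image (fun x => (x.1 i : ℕ)) ⟨x, hx⟩
  let μ : I → ℕ := fun i => (m i).1 i
  obtain ⟨i₁, hi₁, -⟩ := h x
  -- otherwise a grid point exceeding all the minima exists
  have hsum : N < ∑ i ∈ C, (μ i + 1) := by
    by_contra! hle
    -- the coordinate `i₁` takes up the slack, so that the sum is `N`
    let y : I → ℕ := fun i => if i ∈ C then
      μ i + 1 + (if i = i₁ then N - ∑ i ∈ C, (μ i + 1) else 0) else 0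
    have hy : ∑ i, y i = N := by
      simp only [y]
      rw [← sum_filter, filter_mem_eq_inter, univ_inter, sum_add_distrib, sum_ite_eq' C i₁,
        if_pos hi₁]
      omega
    obtain ⟨j, hj, hjle⟩ := h (SimplexGrid.mk y hy)
    have h1 : y j ≤ μ j := hjle _ (hm j)
    simp only [y, if_pos hj] at h1
    omega
  rw [sum_add_distrib, sum_const, smul_eq_mul, mul_one] at hsum
  have hC : #C ≤ Fintype.card I := card_le_univ C
  have hxsum : ∑ i ∈ C, (x.1 i : ℕ) + ∑ i ∈ Cᶜ, (x.1 i : ℕ) = N := by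
    rw [sum_add_sum_compl]; exact x.2
  have hμx : ∀ i, μ i ≤ x.1 i := fun i => hmin i x hx
  constructor
  · intro hi x' hx'
    have h1 := add_sum_erase C (fun i => (x.1 i : ℕ)) hi
    have h2 := add_sum_erase C μ hi
    have h3 : ∑ j ∈ C.erase i, μ j ≤ ∑ j ∈ C.erase i, (x.1 j : ℕ) := sum_le_sum fun j _ => hμx j
    have h4 : μ i ≤ x'.1 i := hmin i x' hx'
    omega
  · intro hi
    have h1 : (x.1 i : ℕ) ≤ ∑ j ∈ Cᶜ, (x.1 j : ℕ) :=
      single_le_sum (f := fun j => (x.1 j : ℕ)) (fun _ _ => Nat.zero_le _) (mem_compl.2 hi)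
    have h3 : ∑ j ∈ C, μ j ≤ ∑ j ∈ C, (x.1 j : ℕ) := sum_le_sum fun j _ => hμx j
    omega

theorem exists_le_apply_of_mem_stdSimplex [Nonempty I] {x y : I → ℝ}
    (hx : x ∈ stdSimplex ℝ I) (hy : y ∈ stdSimplex ℝ I) : ∃ i, x i ≤ y i := by
  by_contra! h
  have := sum_lt_sum_of_nonempty (univ_nonempty (α := I)) fun i _ => h i
  rw [hx.2, hy.2] at this
  exact lt_irrefl _ this

/-- Approximate form of Brouwer's theorem. Each grid point `x` is coloured by a coordinate `i`
with `x i ≤ f x i`. Scarf's lemma gives a small set `σ`; for a coordinate `i` among its colours `x'`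
is a point of `σ` of colour `i`, and for the others `x' = x`, as `x i` is at most `|I| / N`. -/
theorem exists_approx_fixedPoint [Nonempty I] (f : (I → ℝ) → I → ℝ)
    (hf : ∀ x ∈ stdSimplex ℝ I, f x ∈ stdSimplex ℝ I) {N : ℕ} (hN : 0 < N) :
    ∃ x ∈ stdSimplex ℝ I, ∀ i, ∃ x' ∈ stdSimplex ℝ I,
      (∀ j, |x' j - x j| ≤ Fintype.card I / N) ∧ x' i ≤ f x' i + Fintype.card I / N := by
  classical
  have hN' : (0 : ℝ) < N := by exact_mod_cast hN
  obtain ⟨i₀⟩ := ‹Nonempty I›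
  have : Nonempty (SimplexGrid I N) := ⟨SimplexGrid.mk (Pi.single i₀ N) (by simp)⟩
  have : Nonempty I := ⟨i₀⟩
  choose col hcol using fun t : SimplexGrid I N =>
    exists_le_apply_of_mem_stdSimplex (t.point_mem hN) (hf _ (t.point_mem hN))
  let q := Fintype.equivFin (SimplexGrid I N)
  let M := Fintype.card (SimplexGrid I N)
  -- the coordinate orders, with ties broken by an enumeration of the grid
  let ρ : I → SimplexGrid I N → ℕ := fun i t => q t + M * t.1 i
  have hmod : ∀ i t, ρ i t % M = q t := fun i t => by
    simp only [ρ]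
    rw [Nat.add_mul_mod_self_left, Nat.mod_eq_of_lt (q t).2]
  have hdiv : ∀ i t, ρ i t / M = t.1 i := fun i t => by
    simp only [ρ]
    rw [Nat.add_mul_div_left _ _ Fintype.card_pos, Nat.div_eq_of_lt (q t).2, zero_add]
  obtain ⟨σ, hσ⟩ := Scarf.exists_colorful ρ
    (fun i s t h => q.injective (Fin.ext (by rw [← hmod i s, ← hmod i t, h]))) col
  have hdom : ∀ y : SimplexGrid I N, ∃ i ∈ σ.image col, ∀ x ∈ σ, (y.1 i : ℕ) ≤ x.1 i :=
    fun y => (hσ y).imp fun i hi => ⟨hi.1, fun x hx => by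
      rw [← hdiv i y, ← hdiv i x]
      exact Nat.div_le_div_right (hi.2 x hx)⟩
  obtain ⟨i₁, hi₁, -⟩ := hdom (Classical.arbitrary _)
  obtain ⟨x, hx, -⟩ := mem_image.1 hi₁
  have hle : ∀ x ∈ σ, ∀ x' ∈ σ, ∀ j, (x.1 j : ℕ) ≤ x'.1 j + Fintype.card I := by
    intro x hx x' hx' j
    by_cases hj : j ∈ σ.image col
    · exact (SimplexGrid.close_of_dominant hdom hx j).1 hj x' hx'
    · exact ((SimplexGrid.close_of_dominant hdom hx j).2 hj).trans (Nat.le_add_left _ _)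
  have hdist : ∀ x ∈ σ, ∀ x' ∈ σ, ∀ j, x.point j - x'.point j ≤ Fintype.card I / N := by
    intro x hx x' hx' j
    simp only [SimplexGrid.point]
    rw [← sub_div]
    gcongr
    rw [sub_le_iff_le_add']
    exact_mod_cast hle x hx x' hx' j
  refine ⟨x.point, x.point_mem hN, fun i => ?_⟩
  by_cases hi : i ∈ σ.image col
  · obtain ⟨x', hx', rfl⟩ := mem_image.1 hi
    refine ⟨x'.point, x'.point_mem hN, fun j => abs_sub_le_iff.2
      ⟨hdist x' hx' x hx j, hdist x hx x' hx' j⟩, (hcol x').trans ?_⟩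
    exact le_add_of_nonneg_right (by positivity)
  · refine ⟨x.point, x.point_mem hN, fun j => by simp; positivity, ?_⟩
    have h1 := (SimplexGrid.close_of_dominant hdom hx i).2 hi
    have h2 : x.point i ≤ Fintype.card I / N := by
      simp only [SimplexGrid.point]
      gcongr
    exact h2.trans (le_add_of_nonneg_left ((hf _ (x.point_mem hN)).1 i))

/-- Brouwer's fixed point theorem for the standard simplex. -/
theorem stdSimplex.exists_fixedPoint [Nonempty I] (f : (I → ℝ) → I → ℝ)
    (hf : ∀ x ∈ stdSimplex ℝ I, f x ∈ stdSimplex ℝ I) (hcont : ContinuousOn f (stdSimplex ℝ I)) :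
    ∃ x ∈ stdSimplex ℝ I, f x = x := by
  choose x hx x' hx' hclose hle using fun n : ℕ => exists_approx_fixedPoint f hf n.succ_pos
  obtain ⟨a, ha, φ, hφ, hlim⟩ := (isCompact_stdSimplex (𝕜 := ℝ) I).tendsto_subseq hx
  have hε : Tendsto (fun n => (Fintype.card I : ℝ) / ((φ n).succ : ℕ)) atTop (𝓝 0) := by
    have := (tendsto_const_div_atTop_nhds_zero_nat (Fintype.card I : ℝ)).comp
      ((tendsto_add_atTop_nat 1).comp hφ.tendsto_atTop)
    exact this
  have hlim' : ∀ i, Tendsto (fun n => x' (φ n) i) atTop (𝓝 a) := by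
    intro i
    rw [tendsto_pi_nhds] at hlim ⊢
    intro j
    have h0 : Tendsto (fun n => x' (φ n) i j - x (φ n) j) atTop (𝓝 0) :=
      squeeze_zero_norm (fun n => hclose (φ n) i j) hε
    simpa using h0.add (hlim j)
  have hfa : ∀ i, a i ≤ f a i := by
    intro i
    have h1 : Tendsto (fun n => f (x' (φ n) i)) atTop (𝓝 (f a)) :=
      (hcont a ha).tendsto.comp (tendsto_nhdsWithin_iff.2
        ⟨hlim' i, Eventually.of_forall fun n => hx' (φ n) i⟩)
    have h2 := ((tendsto_pi_nhds.1 h1) i).add hε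
    rw [add_zero] at h2
    exact le_of_tendsto_of_tendsto' ((tendsto_pi_nhds.1 (hlim' i)) i) h2 fun n => hle (φ n) i
  refine ⟨a, ha, ?_⟩
  have := (sum_eq_sum_iff_of_le (s := univ) fun i _ => hfa i).1 (ha.2.trans (hf a ha).2.symm)
  exact funext fun i => (this i (mem_univ i)).symm

end Brouwer

/-! ### Partitions of unity and fixed points on compact convex sets -/

section Compact

open Set

/-- A partition of unity subordinate to an open cover of a compact Hausdorff space, indexed by a
finite subset of the index type of the cover. -/
theorem exists_finite_partition_of_open_cover {Z ι : Type*} [TopologicalSpace Z] [CompactSpace Z]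
    [T2Space Z] (U : ι → Set Z) (ho : ∀ i, IsOpen (U i)) (hU : ∀ x, ∃ i, x ∈ U i) :
    ∃ (s : Finset ι) (φ : s → C(Z, ℝ)), (∀ i x, 0 ≤ φ i x) ∧ (∀ x, ∑ i, φ i x = 1) ∧
      ∀ i x, φ i x ≠ 0 → x ∈ U i := by
  obtain ⟨s, hs⟩ := isCompact_univ.elim_finite_subcover U ho fun x _ => mem_iUnion.2 (hU x)
  obtain ⟨φ, hφ⟩ := PartitionOfUnity.exists_isSubordinate (isClosed_univ (X := Z))
    (fun i : s => U i) (fun i => ho i) fun x hx => by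
      obtain ⟨i, hi, hxi⟩ := mem_iUnion₂.1 (hs hx)
      exact mem_iUnion.2 ⟨⟨i, hi⟩, hxi⟩
  refine ⟨s, fun i => φ i, fun i x => φ.nonneg i x, fun x => ?_, fun i x hx => ?_⟩
  · rw [← finsum_eq_sum_of_fintype]
    exact φ.sum_eq_one (mem_univ x)
  · exact hφ i (subset_tsupport _ hx)

/-- A set-valued form of Brouwer's theorem (Browder): if every point of a compact convex set `K`
lies in some `V k`, with `V k` open in `K`, then some `x` is a convex combination of points `k`
with `x ∈ V k`. -/
theorem exists_mem_convexHull_of_open_cover {X : Type*} [AddCommGroup X] [Module ℝ X]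
    [TopologicalSpace X] [IsTopologicalAddGroup X] [ContinuousSMul ℝ X] [T2Space X] {K : Set X}
    (hK : IsCompact K) (hne : K.Nonempty) (hconv : Convex ℝ K) (V : K → Set K)
    (ho : ∀ k, IsOpen (V k)) (hV : ∀ x, ∃ k, x ∈ V k) :
    ∃ x : K, (x : X) ∈ convexHull ℝ (Subtype.val '' {k | x ∈ V k}) := by
  have : CompactSpace K := isCompact_iff_compactSpace.1 hK
  obtain ⟨s, φ, hφ0, hφ1, hφV⟩ := exists_finite_partition_of_open_cover V ho hV
  have : Nonempty s := by
    by_contra hs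
    rw [not_nonempty_iff] at hs
    simpa using hφ1 ⟨_, hne.some_mem⟩
  have hmem : ∀ t ∈ stdSimplex ℝ s, ∑ k, t k • ((k : K) : X) ∈ K := fun t ht =>
    hconv.sum_mem (fun k _ => ht.1 k) ht.2 fun k _ => (k : K).2
  let e : stdSimplex ℝ s → K := fun t => ⟨_, hmem t t.2⟩
  have he : Continuous e := by
    refine Continuous.subtype_mk (continuous_finsetSum _ fun k _ => ?_) _
    exact ((continuous_apply k).comp continuous_subtype_val).smul continuous_const
  classical
  -- Brouwer's theorem is applied to the coordinates of the map `x ↦ ∑ k, φ k x • k`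
  let F : (s → ℝ) → s → ℝ := fun t =>
    if ht : t ∈ stdSimplex ℝ s then fun k => φ k (e ⟨t, ht⟩) else t
  have hF : ∀ (t : s → ℝ) (ht : t ∈ stdSimplex ℝ s), F t = fun k => φ k (e ⟨t, ht⟩) :=
    fun t ht => dif_pos ht
  obtain ⟨t, ht, hfix⟩ := stdSimplex.exists_fixedPoint F
    (fun t ht => by
      rw [hF t ht]
      exact ⟨fun k => hφ0 k _, hφ1 _⟩)
    (by
      rw [continuousOn_iff_continuous_domRestrict]
      have : (stdSimplex ℝ s).domRestrict F = fun t k => φ k (e t) :=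
        funext fun t => hF t t.2
      rw [this]
      exact continuous_pi fun k => (φ k).continuous.comp he)
  rw [hF t ht] at hfix
  refine ⟨e ⟨t, ht⟩, ?_⟩
  rw [show ((e ⟨t, ht⟩ : K) : X) = ∑ k, t k • ((k : K) : X) from rfl,
    ← Finset.sum_filter_of_ne (p := fun k => t k ≠ 0) fun k _ hk h => hk (by rw [h, zero_smul])]
  refine (convex_convexHull ℝ _).sum_mem (fun k _ => ht.1 k) ?_ fun k hk => ?_
  · rw [Finset.sum_filter_ne_zero]
    exact ht.2
  · refine subset_convexHull ℝ _ ⟨k, hφV k _ ?_, rfl⟩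
    rw [congrFun hfix k]
    exact (Finset.mem_filter.1 hk).2

/-- If the graph of `f` is compact and its domain is Hausdorff, then the projection of the graph to
the domain is a closed map, so its inverse is continuous; no separation of `Y` is needed. -/
theorem continuous_graphMap_of_isCompact {X Y : Type*} [TopologicalSpace X] [T2Space X]
    [TopologicalSpace Y] {K : Set X} {f : K → Y}
    (h : IsCompact (range fun k : K => ((k : X), f k))) :
    Continuous fun k : K => ((k : X), f k) := by
  refine continuous_iff_isClosed.2 fun A hA => ?_
  have hc := ((h.inter_right hA).image continuous_fst).isClosed.preimage
    (continuous_subtype_val (p := (· ∈ K)))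
  convert hc using 1
  ext x
  constructor
  · exact fun hx => ⟨_, ⟨⟨x, rfl⟩, hx⟩, rfl⟩
  · rintro ⟨_, ⟨⟨x', rfl⟩, hx'⟩, hxx'⟩
    rwa [← Subtype.ext hxx']

end Compact

/-! ### Monotone operators -/

namespace DualSystem

variable {X Y : Type*} [AddCommGroup X] [Module ℝ X] [AddCommGroup Y] [Module ℝ Y]

theorem convFun_couplingOn_sum_le (c : X →ₗ[ℝ] Y →ₗ[ℝ] ℝ) {T : X → Set Y} {ι : Type*} [Fintype ι]
    {w : ι → ℝ} {z : ι → X × Y} (hw0 : ∀ i, 0 ≤ w i) (hw1 : ∑ i, w i = 1)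
    (hz : ∀ i, z i ∈ graph T) :
    convFun (couplingOn c T) (∑ i, w i • z i) ≤ ((∑ i, w i * c (z i).1 (z i).2 : ℝ) : EReal) := by
  refine sInf_le ⟨_, ?_, rfl⟩
  have hmem : ∀ i, (z i, c (z i).1 (z i).2) ∈ epi (couplingOn c T) := fun i => by
    simp [epi, couplingOn, hz i]
  have := (convex_convexHull ℝ (epi (couplingOn c T))).sum_mem (t := Finset.univ)
    (fun i _ => hw0 i) hw1 fun i _ => subset_convexHull ℝ _ (hmem i)
  have heq : ∑ i, w i • (z i, c (z i).1 (z i).2) =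
      (∑ i, w i • z i, ∑ i, w i * c (z i).1 (z i).2) := by
    ext1
    · simp [Prod.fst_sum]
    · simp [Prod.snd_sum]
  rwa [heq] at this

/-- The core of the argument, with the topological hypotheses reduced to continuity of the forms
`x ↦ c x v` and `x ↦ c u (f x)` on `K` and upper semicontinuity of `x ↦ c x (f x)`. -/
theorem exists_isMonotonicallyRelated (c : X →ₗ[ℝ] Y →ₗ[ℝ] ℝ) [TopologicalSpace X]
    [IsTopologicalAddGroup X] [ContinuousSMul ℝ X] [T2Space X] {K : Set X} (hKne : K.Nonempty)
    (hKconv : Convex ℝ K) (hKcomp : IsCompact K) {f : K → Y} {T : X → Set Y}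
    (hineq : ∀ z ∈ convexHull ℝ (graph T), ∀ w ∈ Set.range f,
      (⨅ k : K, ((c (k : X) (z.2 - w) : ℝ) : EReal)) + ((c z.1 w : ℝ) : EReal)
        ≤ convFun (couplingOn c T) z)
    (hleft : ∀ v, Continuous fun x : K => c x v)
    (hright : ∀ u, Continuous fun x : K => c u (f x))
    (husc : UpperSemicontinuous fun x : K => c x (f x)) :
    ∃ x : K, IsMonotonicallyRelated c ((x : X), f x) (graph T) := by
  by_contra! hcon
  simp only [IsMonotonicallyRelated, not_forall, not_le, exists_prop] at hcon
  have : CompactSpace K := isCompact_iff_compactSpace.1 hKcomp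
  have hopen : ∀ h : K → ℝ, Continuous h → IsOpen {x : K | c x (f x) + h x < 0} := fun h hh =>
    (husc.add hh.upperSemicontinuous).isOpen_preimage 0
  -- weights concentrated on points of the graph that violate the monotone relation to `(x, f x)`
  obtain ⟨s, φ, hφ0, hφ1, hφU⟩ := exists_finite_partition_of_open_cover
    (fun (w : graph T) => {x : K | c (x - w.1.1) (f x - w.1.2) < 0})
    (fun w => by
      have heq : ∀ x : K, c (x - w.1.1) (f x - w.1.2) =
          c x (f x) + (c w.1.1 w.1.2 - c x w.1.2 - c w.1.1 (f x)) := fun x => by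
        simp only [map_sub, LinearMap.sub_apply]
        ring
      simp only [heq]
      exact hopen _ ((continuous_const.sub (hleft _)).sub (hright _)))
    (fun x => by
      obtain ⟨w, hw, hlt⟩ := hcon x
      exact ⟨⟨w, hw⟩, hlt⟩)
  let z : K → X × Y := fun x => ∑ i, φ i x • (i : graph T).1
  have hz1 : ∀ x, (z x).1 = ∑ i, φ i x • (i : graph T).1.1 := fun x => by simp [z, Prod.fst_sum]
  have hz2 : ∀ x, (z x).2 = ∑ i, φ i x • (i : graph T).1.2 := fun x => by simp [z, Prod.snd_sum]
  have hcover : ∀ x : K, ∃ k : K, c (k - x) ((z x).2 - f x) < 0 := by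
    intro x
    have hneg : ∑ i, φ i x * c (x - (i : graph T).1.1) (f x - (i : graph T).1.2) < 0 := by
      have hterm : ∀ i, φ i x * c (x - (i : graph T).1.1) (f x - (i : graph T).1.2) ≤ 0 ∧
          (φ i x ≠ 0 →
            φ i x * c (x - (i : graph T).1.1) (f x - (i : graph T).1.2) < 0) := fun i => by
        by_cases h : φ i x = 0
        · simp [h]
        · have := mul_neg_of_pos_of_neg ((hφ0 i x).lt_of_ne' h) (hφU i x h)
          exact ⟨this.le, fun _ => this⟩
      obtain ⟨i, -, hi⟩ := Finset.exists_ne_zero_of_sum_ne_zero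
        ((hφ1 x).trans_ne one_ne_zero)
      exact Finset.sum_neg' (fun i _ => (hterm i).1) ⟨i, Finset.mem_univ i, (hterm i).2 hi⟩
    have hexp : ∑ i, φ i x * c (x - (i : graph T).1.1) (f x - (i : graph T).1.2) =
        c x (f x) - c x (z x).2 - c (z x).1 (f x) +
          ∑ i, φ i x * c (i : graph T).1.1 (i : graph T).1.2 := by
      have h1 : c x (f x) = ∑ i, φ i x * c x (f x) := by rw [← Finset.sum_mul, hφ1, one_mul]
      rw [h1, hz1, hz2]
      simp only [map_sum, map_smul, LinearMap.sum_apply, LinearMap.smul_apply, smul_eq_mul]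
      rw [← Finset.sum_sub_distrib, ← Finset.sum_sub_distrib, ← Finset.sum_add_distrib]
      refine Finset.sum_congr rfl fun i _ => ?_
      simp only [map_sub, LinearMap.sub_apply]
      ring
    have hle := (hineq (z x)
      ((convex_convexHull ℝ _).sum_mem (fun i _ => hφ0 i x) (hφ1 x) fun i _ =>
        subset_convexHull ℝ _ (i : graph T).2) (f x) ⟨x, rfl⟩).trans
      (convFun_couplingOn_sum_le c (fun i => hφ0 i x) (hφ1 x) fun i => (i : graph T).2)
    by_contra! hge
    have hinf : ((c x ((z x).2 - f x) : ℝ) : EReal) ≤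
        ⨅ k : K, ((c (k : X) ((z x).2 - f x) : ℝ) : EReal) := le_iInf fun k => by
      have := hge k
      rw [map_sub c, LinearMap.sub_apply, sub_nonneg] at this
      exact_mod_cast this
    have hfin := (add_le_add_left hinf _).trans hle
    rw [← EReal.coe_add, EReal.coe_le_coe_iff, map_sub] at hfin
    rw [hexp] at hneg
    linarith
  obtain ⟨x, hx⟩ := exists_mem_convexHull_of_open_cover hKcomp hKne hKconv
    (fun k => {x : K | c (k - x) ((z x).2 - f x) < 0})
    (fun k => by
      have hcont : ∀ u : K → X, (∀ v, Continuous fun x => c (u x) v) →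
          Continuous fun x => c (u x) (z x).2 := fun u hu => by
        simp only [hz2, map_sum, map_smul, smul_eq_mul]
        exact continuous_finsetSum _ fun i _ => (φ i).continuous.mul (hu _)
      have heq : ∀ x : K, c (k - x) ((z x).2 - f x) =
          c x (f x) + (c k (z x).2 - c k (f x) - c x (z x).2) := fun x => by
        simp only [map_sub, LinearMap.sub_apply]
        ring
      simp only [heq]
      exact hopen _ (((hcont (fun _ => k) fun _ => continuous_const).sub (hright _)).sub
        (hcont (fun x => x) hleft)))
    hcover
  have hhalf : Convex ℝ {u : X | c.flip ((z x).2 - f x) u < c.flip ((z x).2 - f x) x} :=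
    convex_halfSpace_lt (c.flip ((z x).2 - f x)).isLinear _
  suffices hsub : Subtype.val '' {k : K | c (k - x) ((z x).2 - f x) < 0} ⊆ _ from
    lt_irrefl (c.flip ((z x).2 - f x) x) (convexHull_min hsub hhalf hx)
  rintro _ ⟨k, hk, rfl⟩
  have hk : c (k - x) ((z x).2 - f x) < 0 := hk
  rw [map_sub c, LinearMap.sub_apply, sub_neg] at hk
  exact hk

end DualSystem

theorem mainTheorem4 {X Y : Type*} [AddCommGroup X] [Module ℝ X] [AddCommGroup Y] [Module ℝ Y]
    (c : X →ₗ[ℝ] Y →ₗ[ℝ] ℝ)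
    (K : Set X) (hKne : K.Nonempty) (hKconv : Convex ℝ K) (f : K → Y)
    (T : X → Set Y) (hTne : (DualSystem.graph T).Nonempty) (hT : DualSystem.IsMonotone c T)
    (hineq : ∀ z ∈ convexHull ℝ (DualSystem.graph T), ∀ w ∈ Set.range f,
      (⨅ k : K, ((c (k : X) (z.2 - w) : ℝ) : EReal)) + ((c z.1 w : ℝ) : EReal)
        ≤ DualSystem.convFun (DualSystem.couplingOn c T) z)
    [βX : TopologicalSpace X] [IsTopologicalAddGroup X] [ContinuousSMul ℝ X]
    [LocallyConvexSpace ℝ X] [T2Space X]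
    (hKcomp : IsCompact K)
    (hGcomp : @IsCompact (X × Y) (@instTopologicalSpaceProd X Y βX (DualSystem.sigmaRight c))
      (DualSystem.funGraph f))
    (hfiner : TopologicalSpace.induced (Subtype.val : K → X) βX ≤
      TopologicalSpace.induced (Subtype.val : K → X) (DualSystem.sigmaLeft c))
    (husc : @UpperSemicontinuousOn (X × Y) ℝ
      (@instTopologicalSpaceProd X Y βX (DualSystem.sigmaRight c)) _
      (fun z => c z.1 z.2) (DualSystem.funGraph f)) :
    (DualSystem.graph (DualSystem.plus c T) ∩ DualSystem.funGraph f).Nonempty ∧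
      ∃ x : K, DualSystem.IsMonotonicallyRelated c ((x : X), f x) (DualSystem.graph T) := by
  let _ : TopologicalSpace Y := DualSystem.sigmaRight c
  have hgraph : Continuous fun k : K => ((k : X), f k) := continuous_graphMap_of_isCompact hGcomp
  have hright : ∀ u, Continuous fun x : K => c u (f x) := fun u =>
    (WeakBilin.eval_continuous c.flip u).comp (continuous_snd.comp hgraph)
  have hleft : ∀ v, Continuous fun x : K => c x v := fun v =>
    (WeakBilin.eval_continuous c v).comp (continuous_le_dom hfiner continuous_induced_dom)
  have husc' : UpperSemicontinuous fun x : K => c x (f x) := fun x b hb =>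
    (tendsto_nhdsWithin_iff.2 ⟨hgraph.tendsto x, Filter.Eventually.of_forall fun k =>
      Set.mem_range_self (f := fun k : K => ((k : X), f k)) k⟩)
      (husc _ ⟨x, rfl⟩ b hb)
  obtain ⟨x, hx⟩ := DualSystem.exists_isMonotonicallyRelated c hKne hKconv hKcomp hineq
    hleft hright husc'
  exact ⟨⟨((x : X), f x), hx, x, rfl⟩, x, hx⟩
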